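/- Let $k\ge 0$ be an integer and let $(E,\mathcal I)$ be a matroid $k$-parity constraint: there is a matroid $\mathcal M$ whose ground set is partitioned into finitely many disjoint sets $v(e)$, $e\in E$, each with at most $k$ elements, and $\mathcal I$ consists of all $S\subseteq E$ such that $\bigcup_{e\in S}v(e)$ is independent in $\mathcal M$. Let $f\colon 2^E\to\mathbb R_{\ge 0}$ be submodular and let $\varepsilon\in(0,1)$. Write $f(e\mid S)=f(S\cup\{e\})-f(S)$ and $f(T\mid S)=f(S\cup T)-f(S)$. For $\theta>0$ and $A\in\mathcal I$, a pair $S\subseteq E\setminus A$, $N\subseteq A$ is a $(\theta,\varepsilon)$-improvement for $A$ if $(A\cup S)\setminus N\in\mathcal I$ and one of the following holds: (1) $S=\{x\}$, $N=\emptyset$ and $f(x\mid A)\ge\theta$; (2) $S=\{x\}$, $N=\{y\}$, $f(x\mid A)\ge\theta$ and $f((A\cup\{x\})\setminus\{y\})\ge f(A)+\varepsilon\theta$; (3) $S=\{x_1,x_2\}$ with $x_1\ne x_2$, $N=\{y\}$, $f(x_1\mid A)\ge\theta$ and $f(x_2\mid A\cup\{x_1\})\ge\theta$, for at least one of the two labellings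 of $S$. Consider the following algorithm. Let $W=\max_{e\in E}f(e\mid\emptyset)$, draw $\alpha$ uniformly at random from $(0,1]$, and let $m_i=W2^{\alpha-i}$ for $i\ge 0$. Start with $i=0$ and $A_{\le 0}=\emptyset$. While there is an $e\in E\setminus A_{\le i}$ with $f(e\mid A_{\le i})>0$ and $A_{\le i}\cup\{e\}\in\mathcal I$: increase $i$ by $1$; let $A_i=\emptyset$; as long as there is an $(m_i,\varepsilon)$-improvement $(S,N)$ for $A_{\le i-1}\cup A_i$ with $N\subseteq A_i$, choose an arbitrary one (the choice may be randomized) and replace $A_i$ by $(A_i\setminus N)\cup S$; then let $A_{\le i}=A_{\le i-1}\cup A_i$. When the outer loop ends, return $A=A_{\le i}$. Then every execution of the algorithm terminates, and for every real $d\ge 2$ and every $O\in\mathcal I$ with $f(x\mid O\setminus\{x\})>0$ for all $x\in O$ (that is, every strictly down-monotone feasible $O$), the random output set $A$ satisfies $$(k+d+1+2\varepsilon)\cdot\mathbb E[f(A)]\ \ge\ d'\cdot f(O)+d\cdot\mathbb E[f(A\mid O)],\qquad d'=\frac{1-1/d}{2\ln 2}+\frac{d+1}{2d}.$$ -/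

import Mathlib

namespace MatroidParity

variable {E V : Type*}

/-- The marginal contribution `f(e ∣ S) = f(S + e) - f(S)` of an element. -/
def marg [DecidableEq E] (f : Finset E → ℝ) (e : E) (S : Finset E) : ℝ :=
  f (insert e S) - f S

/-- The marginal contribution `f(T ∣ S) = f(S ∪ T) - f(S)` of a set. -/
def margSet [DecidableEq E] (f : Finset E → ℝ) (T S : Finset E) : ℝ :=
  f (S ∪ T) - f S

/-- Submodularity, as diminishing marginal contributions. -/
def Submodular [DecidableEq E] (f : Finset E → ℝ) : Prop :=
  ∀ S T : Finset E, S ⊆ T → ∀ e, e ∉ T → marg f e T ≤ marg f e S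

/-- The data of a matroid `k`-parity constraint: the vertex sets `v e` of the edges `e : E` are
pairwise disjoint, have at most `k` elements each, and together make up the ground set of the
matroid `M`. (An edge without vertices is not excluded.) -/
structure IsParity (M : Matroid V) (v : E → Finset V) (k : ℕ) : Prop where
  disjoint : ∀ e e', e ≠ e' → Disjoint (v e) (v e')
  cover : ⋃ e, (v e : Set V) = M.E
  card_le : ∀ e, (v e).card ≤ k

/-- A set of edges is feasible if the union of its edges is independent in the matroid. -/
def Feasible (M : Matroid V) (v : E → Finset V) (S : Finset E) : Prop :=
  M.Indep (⋃ e ∈ S, (v e : Set V))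

/-- A set `O` is strictly down-monotone if `f(x ∣ O - x) > 0` for every `x ∈ O`. -/
def StrictlyDownMonotone [DecidableEq E] (f : Finset E → ℝ) (O : Finset E) : Prop :=
  ∀ x ∈ O, 0 < marg f x (O.erase x)

/-- `(S, N)` is a `(θ, ε)`-improvement for the set `A`, where `I` is the family of feasible
sets. -/
def IsImprovement [DecidableEq E] (f : Finset E → ℝ) (I : Finset E → Prop) (θ ε : ℝ)
    (A S N : Finset E) : Prop :=
  Disjoint S A ∧ N ⊆ A ∧ I ((A ∪ S) \ N) ∧
    ((∃ x, S = {x} ∧ N = ∅ ∧ θ ≤ marg f x A) ∨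
     (∃ x y, S = {x} ∧ N = {y} ∧ θ ≤ marg f x A ∧ f A + ε * θ ≤ f ((insert x A).erase y)) ∨
     (∃ x₁ x₂ y, x₁ ≠ x₂ ∧ S = {x₁, x₂} ∧ N = {y} ∧
        θ ≤ marg f x₁ A ∧ θ ≤ marg f x₂ (insert x₁ A)))

/-- `W = max_{e ∈ E} f(e ∣ ∅)` (with the irrelevant value `0` if there are no elements). -/
noncomputable def maxMarg [DecidableEq E] (f : Finset E → ℝ) : ℝ :=
  ⨆ e : E, marg f e ∅

/-- The threshold `m_i = W τ 2^{-i}` with `τ = 2^α`. -/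
noncomputable def threshold [DecidableEq E] (f : Finset E → ℝ) (α : ℝ) (i : ℕ) : ℝ :=
  maxMarg f * (2 : ℝ) ^ α / 2 ^ i

/-- The condition of the outer loop of the algorithm at the current set `B`. -/
def CanExtend [DecidableEq E] (f : Finset E → ℝ) (I : Finset E → Prop) (B : Finset E) : Prop :=
  ∃ e, e ∉ B ∧ 0 < marg f e B ∧ I (insert e B)

/-- The states of the algorithm: `outer i B` is the state in which the condition of the outer loop
is about to be checked after `i` iterations, with `B = A_{≤ i}`; `inner i B C` is the state in
which the condition of the inner loop is about to be checked in iteration `i`, with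
`B = A_{≤ i-1}` and `C` the current value of `A_i`. -/
inductive State (E : Type*) where
  | outer (i : ℕ) (B : Finset E) : State E
  | inner (i : ℕ) (B C : Finset E) : State E

/-- One step of the algorithm, for a given value of `α`. The improvement that is applied
is arbitrary. -/
inductive Step [DecidableEq E] (f : Finset E → ℝ) (I : Finset E → Prop) (ε α : ℝ) :
    State E → State E → Prop where
  | enter (i : ℕ) (B : Finset E) (h : CanExtend f I B) :
      Step f I ε α (State.outer i B) (State.inner (i + 1) B ∅)
  | improve (i : ℕ) (B C S N : Finset E)
      (h : IsImprovement f I (threshold f α i) ε (B ∪ C) S N) (hN : N ⊆ C) :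
      Step f I ε α (State.inner i B C) (State.inner i B ((C \ N) ∪ S))
  | leave (i : ℕ) (B C : Finset E)
      (h : ¬ ∃ S N, IsImprovement f I (threshold f α i) ε (B ∪ C) S N ∧ N ⊆ C) :
      Step f I ε α (State.inner i B C) (State.outer i (B ∪ C))

/-- `A` can be returned by an execution of the algorithm with the given value of `α`. -/
def IsOutput [DecidableEq E] (f : Finset E → ℝ) (I : Finset E → Prop) (ε α : ℝ)
    (A : Finset E) : Prop :=
  ∃ i, Relation.ReflTransGen (Step f I ε α) (State.outer 0 ∅) (State.outer i A) ∧
    ¬ CanExtend f I A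

/-- Every execution of the algorithm with the given value of `α` is finite. -/
def Terminates [DecidableEq E] (f : Finset E → ℝ) (I : Finset E → Prop) (ε α : ℝ) : Prop :=
  ¬ ∃ s : ℕ → State E, s 0 = State.outer 0 ∅ ∧ ∀ n, Step f I ε α (s n) (s (n + 1))

end MatroidParity

/-! Order `O`, let `pre o` be the predecessors of `o`, and put w_o = f(o ∣ pre o) and u_o = f(o ∣ A
∪ pre o). These sum to f(O) - f(∅) and f(O ∪ A) - f(A), and u_o ≤ w_o.

Charging (`ChargeInv.succ`, `exists_charging`): (k+1)(f(A) - f(∅)) can be split into payments p_o ≥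
0 such that p_o ≥ 2m_j for every j ≥ 1 with m_j ≤ u_o (o ∉ A). A set X of vertices of `O` compatible
with the current solution is maintained. An iteration with threshold θ that adds a block C gains at
least θ|C| and destroys at most k|C| vertices of X, each of which pays θ to its owner. An element of
large marginal contribution that loses at least two vertices thus gets 2θ; one that loses none would
be an improvement of type (1). Those that lose exactly one get an extra θ, which is affordable
because there are at most |C| of them: otherwise `exists_exchange_two` trades one element of C for
two of them, an improvement of type (3) (`card_single_conflict_le`).

Averaging: if w_o 2^{-s} is the largest threshold not above w_o, then d·u_o - p_o ≤ w_o · `lossFun d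
s` (`mul_sub_le_lossFun`). For uniform α, s is uniform modulo 1, and `lossFun d` has mean d -
d·log₂(1+1/d). Summing over `O` gives the bound with d·log₂(1+1/d), which is at least d'
(`approximation_factor_le`).

Termination: inner steps increase f, and the thresholds eventually drop below every positive
marginal contribution. -/

namespace MatroidParity

open Finset

/-! ### Matroid rank and the one-for-two exchange. -/

section Rank

variable {E V : Type*} {M : Matroid V}

/-- The rank of a finite set in a matroid, as a natural number. -/
noncomputable def finRank (M : Matroid V) (s : Finset V) : ℕ := (M.eRk (s : Set V)).toNat

lemma coe_finRank (M : Matroid V) (s : Finset V) :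
    (finRank M s : ℕ∞) = M.eRk (s : Set V) :=
  ENat.natCast_toNat (Matroid.eRk_ne_top_iff.2 (M.isRkFinite_of_finite s.finite_toSet))

lemma finRank_mono (M : Matroid V) {s t : Finset V} (h : s ⊆ t) : finRank M s ≤ finRank M t := by
  have := M.eRk_mono (coe_subset.2 h)
  rw [← coe_finRank, ← coe_finRank] at this
  exact_mod_cast this

lemma finRank_eq_card {s : Finset V} (h : M.Indep (s : Set V)) : finRank M s = s.card := by
  have := h.eRk_eq_encard
  rw [← coe_finRank, Set.encard_coe_eq_coe_finsetCard] at this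
  exact_mod_cast this

/-- Every independent subset of a finite set extends to one whose size is the rank. -/
lemma exists_indep_card_eq_finRank {I s : Finset V} (hI : M.Indep (I : Set V)) (hIs : I ⊆ s)
    (hs : (s : Set V) ⊆ M.E) :
    ∃ J, I ⊆ J ∧ J ⊆ s ∧ M.Indep (J : Set V) ∧ J.card = finRank M s := by
  obtain ⟨J, hJ, hIJ⟩ := hI.subset_isBasis_of_subset (coe_subset.2 hIs) hs
  have hfin : J.Finite := s.finite_toSet.subset hJ.subset
  lift J to Finset V using hfin
  refine ⟨J, by exact_mod_cast hIJ, by exact_mod_cast hJ.subset, hJ.indep, ?_⟩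
  have := hJ.encard_eq_eRk
  rw [← coe_finRank, Set.encard_coe_eq_coe_finsetCard] at this
  exact_mod_cast this

variable [DecidableEq V]

lemma finRank_submod (M : Matroid V) (s t : Finset V) :
    finRank M (s ∩ t) + finRank M (s ∪ t) ≤ finRank M s + finRank M t := by
  have h := M.eRk_inter_add_eRk_union_le (s : Set V) (t : Set V)
  rw [← coe_inter, ← coe_union, ← coe_finRank, ← coe_finRank, ← coe_finRank, ← coe_finRank] at h
  exact_mod_cast h

/-- If `Y ∪ X` is independent and `Y ⊆ Y'` with `Y'` independent, then at most `|Y' \ Y|` elements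
have to be dropped from `X` to make it compatible with `Y'`. -/
lemma exists_subset_indep_union {X Y Y' : Finset V} (hYX : M.Indep ((Y ∪ X : Finset V) : Set V))
    (hY' : M.Indep (Y' : Set V)) (hYY' : Y ⊆ Y') :
    ∃ X' ⊆ X, M.Indep ((Y' ∪ X' : Finset V) : Set V) ∧ finRank M (Y' ∪ X) = (Y' ∪ X').card ∧
      (X \ X').card ≤ (Y' \ Y).card := by
  have hXE : (X : Set V) ⊆ M.E := (coe_subset.2 subset_union_right).trans hYX.subset_ground
  obtain ⟨J, hYJ, hJs, hJ, hcard⟩ := exists_indep_card_eq_finRank hY'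
    (subset_union_left (s₂ := X)) (by rw [coe_union]; exact Set.union_subset hY'.subset_ground hXE)
  have hJeq : Y' ∪ J ∩ X = J := by
    ext x; have := @hYJ x; have := @hJs x; simp only [mem_union, mem_inter] at *; tauto
  have hsub := finRank_mono M (union_subset_union_left (t := X) hYY')
  rw [finRank_eq_card hYX, ← hcard] at hsub
  -- `J ∩ X` rather than `J \ Y'`: vertices of `X` lying in `Y'` are kept and do not count as
  -- dropped.
  refine ⟨J ∩ X, inter_subset_right, by rwa [hJeq], by rw [hJeq, hcard], ?_⟩
  have h1 : J.card = Y'.card + ((J ∩ X) \ Y').card := by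
    rw [← card_union_of_disjoint disjoint_sdiff, union_sdiff_self_eq_union, hJeq]
  have h2 : (Y ∪ X).card = Y.card + (X \ Y).card := by
    rw [← card_union_of_disjoint disjoint_sdiff, union_sdiff_self_eq_union]
  have h3 : (X \ Y').card = (X \ (J ∩ X)).card + ((J ∩ X) \ Y').card := by
    rw [← card_union_of_disjoint]
    · congr 1
      ext x; have := @hYJ x; simp only [mem_union, mem_inter, mem_sdiff]; tauto
    · rw [disjoint_left]; intro x; simp only [mem_inter, mem_sdiff]; tauto
  have h4 : (X \ Y').card ≤ (X \ Y).card := card_le_card (sdiff_subset_sdiff subset_rfl hYY')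
  have h5 := card_sdiff_add_card_eq_card hYY'
  omega

variable [DecidableEq E]

/-- Iterated submodularity of the rank: as the blocks are disjoint, removing `v y` and removing the
other blocks give sets whose union is `D ∪ J` and whose intersection lacks all the blocks. -/
lemma card_mul_finRank_le {v : E → Finset V} (D J : Finset V) (C : Finset E)
    (hv : ∀ e e', e ≠ e' → Disjoint (v e) (v e')) :
    C.card * finRank M (D ∪ J) + finRank M (D ∪ J \ C.biUnion v)
      ≤ ∑ y ∈ C, finRank M (D ∪ J \ v y) + finRank M (D ∪ J) := by
  induction C using Finset.induction_on with
  | empty => simp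
  | insert y C hy ih =>
    rw [card_insert_of_notMem hy, sum_insert hy]
    have h := finRank_submod M (D ∪ J \ v y) (D ∪ J \ C.biUnion v)
    have h1 : (D ∪ J \ v y) ∩ (D ∪ J \ C.biUnion v) = D ∪ J \ (insert y C).biUnion v := by
      rw [biUnion_insert]; ext x; simp only [mem_union, mem_inter, mem_sdiff]; tauto
    have hd : Disjoint (v y) (C.biUnion v) := by
      rw [disjoint_biUnion_right]
      exact fun e he => hv y e (by rintro rfl; exact hy he)
    have h2 : (D ∪ J \ v y) ∪ (D ∪ J \ C.biUnion v) = D ∪ J := by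
      ext x; have : x ∈ v y → x ∉ C.biUnion v := fun h => disjoint_left.1 hd h
      simp only [mem_union, mem_sdiff]; tauto
    rw [h1, h2] at h
    linarith

/-- If a set `D` in the span of the independent set `J` remains independent with what is left of `J`
after the removal of disjoint blocks, and `D` has more elements than there are blocks, then some
block can be exchanged for two elements of `D`. -/
lemma exists_exchange_two {v : E → Finset V} {D J : Finset V} {C : Finset E}
    (hv : ∀ e e', e ≠ e' → Disjoint (v e) (v e')) (hJ : M.Indep (J : Set V))
    (hvJ : ∀ y ∈ C, v y ⊆ J) (hDJ : Disjoint D J)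
    (hD : M.Indep ((D ∪ J \ C.biUnion v : Finset V) : Set V))
    (hrank : finRank M (D ∪ J) = J.card) (hcard : C.card < D.card) :
    ∃ y ∈ C, ∃ d₁ ∈ D, ∃ d₂ ∈ D, d₁ ≠ d₂ ∧
      M.Indep ((insert d₁ (insert d₂ (J \ v y)) : Finset V) : Set V) := by
  by_contra! hno
  have hDE : (D : Set V) ⊆ M.E := (coe_subset.2 subset_union_left).trans hD.subset_ground
  -- A basis extending `J \ v y` by two elements of `D` would be the exchange sought.
  have hle : ∀ y ∈ C, finRank M (D ∪ J \ v y) ≤ (J \ v y).card + 1 := by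
    intro y hy
    obtain ⟨K, hJK, hK, hKi, hKc⟩ := exists_indep_card_eq_finRank (M := M) (I := J \ v y)
      (s := D ∪ J \ v y) (hJ.subset (coe_subset.2 sdiff_subset)) subset_union_right
      (by rw [coe_union]
          exact Set.union_subset hDE ((coe_subset.2 sdiff_subset).trans hJ.subset_ground))
    have h1 : (K \ (J \ v y)).card ≤ 1 := by
      rw [card_le_one]
      intro a ha b hb
      by_contra hab
      have hmem : ∀ x ∈ K \ (J \ v y), x ∈ D := fun x hx => by
        have := @hK x
        rw [mem_sdiff] at hx
        rw [mem_union] at this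
        tauto
      refine hno y hy a (hmem a ha) b (hmem b hb) hab (hKi.subset (coe_subset.2 ?_))
      exact insert_subset (mem_sdiff.1 ha).1 (insert_subset (mem_sdiff.1 hb).1 hJK)
    have h2 := card_sdiff_add_card_eq_card hJK
    omega
  -- With all ranks inserted, the terms in |J| and |v y| cancel and |D| ≤ |C| remains.
  have hsum := card_mul_finRank_le (M := M) D J C hv
  have hC : C.biUnion v ⊆ J := biUnion_subset.2 hvJ
  rw [hrank, finRank_eq_card hD,
    card_union_of_disjoint (hDJ.mono_right sdiff_subset)] at hsum
  have h3 := sum_le_sum hle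
  rw [sum_add_distrib] at h3
  have h4 : ∑ y ∈ C, (J \ v y).card + (C.biUnion v).card = C.card * J.card := by
    rw [card_biUnion fun a _ b _ hab => hv a b hab, ← sum_add_distrib,
      sum_congr rfl fun y hy => card_sdiff_add_card_eq_card (hvJ y hy)]
    simp
  have h5 := card_sdiff_add_card_eq_card hC
  simp only [sum_const, smul_eq_mul, mul_one] at h3
  omega

end Rank

/-! ### Submodular functions and sets grown by large marginal contributions. -/

section SubmodularFunctions

variable {E : Type*} [DecidableEq E] {f : Finset E → ℝ}

lemma marg_of_mem {e : E} {S : Finset E} (h : e ∈ S) : marg f e S = 0 := by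
  simp [marg, insert_eq_of_mem h]

/-- A finite set can be ordered: with `pre o` the set of predecessors of `o`, marginal
contributions telescope. -/
lemma exists_predecessors (O : Finset E) :
    ∃ pre : E → Finset E, (∀ o ∈ O, pre o ⊆ O.erase o) ∧
      (∀ x ∈ O, ∀ y ∈ O, x ≠ y → x ∈ pre y ∨ y ∈ pre x) ∧
      ∀ (f : Finset E → ℝ) (A : Finset E), ∑ o ∈ O, marg f o (A ∪ pre o) = f (A ∪ O) - f A := by
  induction O using Finset.induction_on with
  | empty => exact ⟨fun _ => ∅, by simp⟩
  | insert a O ha ih =>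
    obtain ⟨pre, h1, h2, h3⟩ := ih
    have hne : ∀ o ∈ O, o ≠ a := by rintro o ho rfl; exact ha ho
    refine ⟨Function.update pre a O, ?_, ?_, ?_⟩
    · intro o ho
      rcases mem_insert.1 ho with rfl | ho
      · simp [erase_insert ha]
      · rw [Function.update_of_ne (hne o ho)]
        exact (h1 o ho).trans (erase_subset_erase _ (subset_insert _ _))
    · intro x hx y hy hxy
      rcases mem_insert.1 hx with rfl | hx <;> rcases mem_insert.1 hy with rfl | hy
      · exact absurd rfl hxy
      · right; rwa [Function.update_self]
      · left; rwa [Function.update_self]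
      · rw [Function.update_of_ne (hne x hx), Function.update_of_ne (hne y hy)]
        exact h2 x hx y hy hxy
    · intro f A
      rw [sum_insert ha, sum_congr rfl fun o ho => by rw [Function.update_of_ne (hne o ho)], h3]
      simp [marg]

/-- `Grown f θ B A` says that `A` arises from `B` by adding elements one by one, each with marginal
contribution at least `θ`. -/
inductive Grown (f : Finset E → ℝ) (θ : ℝ) (B : Finset E) : Finset E → Prop where
  | refl : Grown f θ B B
  | insert (A : Finset E) (x : E) (hA : Grown f θ B A) (hx : x ∉ A) (h : θ ≤ marg f x A) :
      Grown f θ B (insert x A)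

namespace Grown

variable {θ : ℝ} {A B : Finset E}

lemma subset (h : Grown f θ B A) : B ⊆ A := by
  induction h with
  | refl => exact subset_rfl
  | insert A x _ _ _ ih => exact ih.trans (subset_insert _ _)

/-- Deleting an element can only raise the marginal contributions of those added after it. -/
lemma erase (hf : Submodular f) (h : Grown f θ B A) {y : E} (hyB : y ∉ B) :
    Grown f θ B (A.erase y) := by
  induction h with
  | refl => rw [erase_eq_of_notMem hyB]; exact .refl
  | insert A x hA hx hm ih =>
    by_cases hxy : x = y
    · subst hxy; rwa [erase_insert hx]
    · rw [erase_insert_of_ne hxy]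
      exact .insert _ _ ih (fun h => hx (mem_of_mem_erase h))
        (hm.trans (hf _ _ (erase_subset _ _) _ hx))

lemma mul_card_le (h : Grown f θ B A) : θ * (A \ B).card ≤ f A - f B := by
  induction h with
  | refl => simp
  | insert A x hA hx hm ih =>
    rw [insert_sdiff_of_notMem _ (fun h => hx (hA.subset h)),
      card_insert_of_notMem (by simp [hx])]
    unfold marg at hm
    push_cast
    linarith

end Grown

end SubmodularFunctions

/-! ### A finite measure of progress in value. -/

section ValueRank

variable {E : Type*} {f : Finset E → ℝ}

/-- The number of sets of larger value. -/
noncomputable def valueRank [Fintype E] (f : Finset E → ℝ) (A : Finset E) : ℕ :=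
  #{T | f A < f T}

lemma valueRank_lt [Fintype E] {A A' : Finset E} (h : f A < f A') :
    valueRank f A' < valueRank f A := by
  refine card_lt_card (ssubset_iff_of_subset (fun T hT => ?_) |>.2 ⟨A', ?_, ?_⟩)
  · simp only [mem_filter, mem_univ, true_and] at *; exact h.trans hT
  · simpa using h
  · simp

end ValueRank

/-! ### Invariants and termination of the algorithm. -/

section Algorithm

variable {E : Type*} [DecidableEq E] {f : Finset E → ℝ} {I : Finset E → Prop} {ε α θ : ℝ}

lemma Submodular.marg_le (hf : Submodular f) {S T : Finset E} (h : S ⊆ T) {e : E} (he : e ∉ T) :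
    marg f e T ≤ marg f e S := hf S T h e he

lemma union_improve_eq {B C S N : Finset E} (hBC : Disjoint B C)
    (hS : Disjoint S (B ∪ C)) (hN : N ⊆ C) : B ∪ ((C \ N) ∪ S) = ((B ∪ C) ∪ S) \ N := by
  ext x
  have h1 : x ∈ B → x ∉ C := fun h => disjoint_left.1 hBC h
  have h2 : x ∈ S → x ∉ B ∪ C := fun h => disjoint_left.1 hS h
  have h3 := @hN x
  simp only [mem_union, mem_sdiff] at *
  tauto

lemma IsImprovement.cases_eq {A S N : Finset E} (h : IsImprovement f I θ ε A S N) :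
    (∃ x, x ∉ A ∧ (A ∪ S) \ N = insert x A ∧ θ ≤ marg f x A) ∨
    (∃ x y, x ∉ A ∧ N = {y} ∧ (A ∪ S) \ N = (insert x A).erase y ∧ θ ≤ marg f x A ∧
      f A + ε * θ ≤ f ((insert x A).erase y)) ∨
    (∃ x₁ x₂ y, x₁ ∉ A ∧ x₂ ∉ insert x₁ A ∧ N = {y} ∧
      (A ∪ S) \ N = (insert x₂ (insert x₁ A)).erase y ∧
      θ ≤ marg f x₁ A ∧ θ ≤ marg f x₂ (insert x₁ A)) := by
  obtain ⟨hS, -, -, ⟨x, rfl, rfl, hx⟩ | ⟨x, y, rfl, rfl, hx, hy⟩ |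
    ⟨x₁, x₂, y, hne, rfl, rfl, h1, h2⟩⟩ := h
  · exact .inl ⟨x, by simpa using hS, by rw [union_comm, ← insert_eq]; simp, hx⟩
  · exact .inr (.inl ⟨x, y, by simpa using hS, rfl,
      by rw [union_comm, ← insert_eq, sdiff_singleton_eq_erase], hx, hy⟩)
  · rw [disjoint_left] at hS
    refine .inr (.inr ⟨x₁, x₂, y, hS (by simp), ?_, rfl, ?_, h1, h2⟩)
    · simpa [hne.symm] using hS (a := x₂) (by simp)
    · rw [sdiff_singleton_eq_erase]
      congr 1
      ext z
      simp only [mem_union, mem_insert, mem_singleton]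
      tauto

/-- Improvements preserve the property of being grown. -/
lemma Grown.improve (hf : Submodular f) {B C S N : Finset E} (hBC : Disjoint B C)
    (hg : Grown f θ B (B ∪ C)) (h : IsImprovement f I θ ε (B ∪ C) S N) (hN : N ⊆ C) :
    Grown f θ B (B ∪ ((C \ N) ∪ S)) := by
  rw [union_improve_eq hBC h.1 hN]
  have hy : ∀ y, N = {y} → y ∉ B := by
    rintro y rfl hyB
    exact disjoint_left.1 hBC hyB (hN (mem_singleton_self y))
  rcases h.cases_eq with ⟨x, hx, he, h1⟩ | ⟨x, y, hx, hNy, he, h1, -⟩ |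
    ⟨x₁, x₂, y, hx₁, hx₂, hNy, he, h1, h2⟩ <;> rw [he]
  · exact .insert _ _ hg hx h1
  · exact (Grown.insert _ _ hg hx h1).erase hf (hy y hNy)
  · exact (Grown.insert _ _ (.insert _ _ hg hx₁ h1) hx₂ h2).erase hf (hy y hNy)

/-- Improvements increase the value of the solution, provided that the marginal contributions of
the current block of elements are less than twice the threshold. -/
lemma IsImprovement.lt (hf : Submodular f) (hε : 0 < ε) (hθ : 0 < θ) {B C S N : Finset E}
    (hBC : Disjoint B C) (hlt : ∀ y ∈ C, marg f y B < 2 * θ)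
    (h : IsImprovement f I θ ε (B ∪ C) S N) (hN : N ⊆ C) :
    f (B ∪ C) < f (B ∪ ((C \ N) ∪ S)) := by
  rw [union_improve_eq hBC h.1 hN]
  rcases h.cases_eq with ⟨x, hx, he, h1⟩ | ⟨x, y, hx, hNy, he, h1, h2⟩ |
    ⟨x₁, x₂, y, hx₁, hx₂, rfl, he, h1, h2⟩ <;> rw [he]
  · unfold marg at h1; linarith
  · have := mul_pos hε hθ; linarith
  · have hyC : y ∈ C := hN (mem_singleton_self y)
    have hyB : y ∉ B := fun hyB => disjoint_left.1 hBC hyB hyC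
    set T := insert x₂ (insert x₁ (B ∪ C)) with hT
    have hBT : B ⊆ T.erase y := fun z hz => mem_erase.2
      ⟨by rintro rfl; exact hyB hz, by simp [hT, hz]⟩
    -- `B` survives the removal, so losing `y` costs at most f(y ∣ B) < 2θ, while the two additions
    -- gain at least 2θ.
    have h3 := hf.marg_le hBT (notMem_erase y T)
    have h4 : insert y (T.erase y) = T := insert_erase (by simp [hT, hyC])
    have h5 := hlt y hyC
    rw [marg, h4] at h3
    unfold marg at h1 h2 h5 h3
    linarith

/-- The property `R i B` of the outer states, extended to a property of all states. -/
def StateInv (f : Finset E → ℝ) (I : Finset E → Prop) (α : ℝ) (R : ℕ → Finset E → Prop) :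
    State E → Prop
  | .outer i B => R i B
  | .inner i B C => 0 < maxMarg f ∧ ∃ j, i = j + 1 ∧ R j B ∧ Disjoint B C ∧ I (B ∪ C) ∧
      Grown f (threshold f α i) B (B ∪ C)

lemma marg_le_maxMarg [Finite E] (f : Finset E → ℝ) (e : E) : marg f e ∅ ≤ maxMarg f :=
  le_ciSup (f := fun e => marg f e ∅) (Set.finite_range _).bddAbove e

lemma CanExtend.maxMarg_pos [Finite E] (hf : Submodular f) {B : Finset E}
    (h : CanExtend f I B) : 0 < maxMarg f := by
  obtain ⟨e, he, hpos, -⟩ := h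
  exact hpos.trans_le ((hf.marg_le (empty_subset B) he).trans (marg_le_maxMarg f e))

lemma StateInv.step [Finite E] (hf : Submodular f) (hI : ∀ S T, S ⊆ T → I T → I S)
    {R : ℕ → Finset E → Prop}
    (hR : ∀ j B C, 0 < maxMarg f → R j B → Disjoint B C → I (B ∪ C) →
      Grown f (threshold f α (j + 1)) B (B ∪ C) →
      (¬ ∃ S N, IsImprovement f I (threshold f α (j + 1)) ε (B ∪ C) S N ∧ N ⊆ C) →
      R (j + 1) (B ∪ C))
    {s t : State E} (hs : StateInv f I α R s) (h : Step f I ε α s t) : StateInv f I α R t := by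
  cases h with
  | enter i B h =>
    refine ⟨h.maxMarg_pos hf, i, rfl, hs, disjoint_empty_right _, ?_, ?_⟩
    · obtain ⟨e, -, -, he⟩ := h
      exact hI _ _ (by simp) he
    · rw [union_empty]; exact .refl
  | improve i B C S N h hN =>
    obtain ⟨hW, j, rfl, hRB, hBC, hI', hg⟩ := hs
    refine ⟨hW, j, rfl, hRB, ?_, ?_, hg.improve hf hBC h hN⟩
    · exact disjoint_union_right.2 ⟨hBC.mono_right sdiff_subset,
        (h.1.mono_right subset_union_left).symm⟩
    · rw [union_improve_eq hBC h.1 hN]; exact h.2.2.1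
  | leave i B C h =>
    obtain ⟨hW, j, rfl, hRB, hBC, hI', hg⟩ := hs
    exact hR j B C hW hRB hBC hI' hg h

/-- Reduces an invariant of the outer loop to one complete iteration; used for both `Exhausted` and
`ChargeInv`. -/
lemma StateInv.of_reachable [Finite E] (hf : Submodular f) (hI : ∀ S T, S ⊆ T → I T → I S)
    {R : ℕ → Finset E → Prop} (h0 : R 0 ∅)
    (hR : ∀ j B C, 0 < maxMarg f → R j B → Disjoint B C → I (B ∪ C) →
      Grown f (threshold f α (j + 1)) B (B ∪ C) →
      (¬ ∃ S N, IsImprovement f I (threshold f α (j + 1)) ε (B ∪ C) S N ∧ N ⊆ C) →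
      R (j + 1) (B ∪ C))
    {s : State E} (h : Relation.ReflTransGen (Step f I ε α) (.outer 0 ∅) s) :
    StateInv f I α R s := by
  induction h with
  | refl => exact h0
  | tail _ h ih => exact ih.step hf hI hR h

lemma threshold_pos (hW : 0 < maxMarg f) (i : ℕ) : 0 < threshold f α i := by
  unfold threshold; positivity

lemma two_mul_threshold_succ (i : ℕ) : 2 * threshold f α (i + 1) = threshold f α i := by
  unfold threshold; rw [pow_succ]; field_simp

lemma threshold_antitone (hW : 0 < maxMarg f) : Antitone (threshold f α) :=
  antitone_nat_of_succ_le fun i => by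
    have := two_mul_threshold_succ (f := f) (α := α) i
    have := threshold_pos (α := α) hW (i + 1)
    linarith

lemma marg_lt_of_no_improvement {A C : Finset E}
    (h : ¬ ∃ S N, IsImprovement f I θ ε A S N ∧ N ⊆ C) {x : E} (hx : x ∉ A)
    (hI : I (insert x A)) : marg f x A < θ := by
  by_contra! hle
  refine h ⟨{x}, ∅, ⟨by simpa using hx, empty_subset _, ?_, .inl ⟨x, rfl, rfl, hle⟩⟩,
    empty_subset _⟩
  rwa [sdiff_empty, union_comm, ← insert_eq]

/-- The outer states in which no feasible element has a marginal contribution as large as the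
threshold. -/
def Exhausted (f : Finset E → ℝ) (I : Finset E → Prop) (α : ℝ) (i : ℕ) (B : Finset E) : Prop :=
  0 < maxMarg f → ∀ y, y ∉ B → I (insert y B) → marg f y B < threshold f α i

/-- Since α > 0, the threshold m_0 = W·2^α exceeds W, which bounds every marginal contribution. -/
lemma exhausted_zero [Finite E] (hα : 0 < α) : Exhausted f I α 0 ∅ := by
  intro hW y _ _
  refine (marg_le_maxMarg f y).trans_lt ?_
  have := Real.one_lt_rpow (x := 2) (by norm_num) hα
  simp only [threshold, pow_zero, div_one]
  nlinarith

/-- There are finitely many positive marginal contributions and the thresholds tend to 0. -/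
lemma exists_not_canExtend [Finite E] :
    ∃ L, ∀ i B, L ≤ i → 0 < maxMarg f → Exhausted f I α i B → ¬ CanExtend f I B := by
  have key : ∀ᶠ i in Filter.atTop, ∀ p : E × Finset E, 0 < marg f p.1 p.2 →
      threshold f α i < marg f p.1 p.2 := by
    rw [Filter.eventually_all]
    intro p
    by_cases hp : 0 < marg f p.1 p.2
    · have h : Filter.Tendsto (threshold f α) Filter.atTop (nhds 0) := by
        have := (tendsto_pow_atTop_nhds_zero_of_lt_one (r := (1 / 2 : ℝ)) (by norm_num)
          (by norm_num)).const_mul (maxMarg f * (2 : ℝ) ^ α)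
        rw [mul_zero] at this
        refine this.congr fun i => ?_
        rw [threshold, one_div, inv_pow, div_eq_mul_inv]
      filter_upwards [h.eventually_lt_const hp] with i hi _ using hi
    · exact .of_forall fun _ h => absurd h hp
  obtain ⟨L, hL⟩ := Filter.eventually_atTop.1 key
  refine ⟨L, fun i B hi hW hB ⟨e, he, hpos, heI⟩ => ?_⟩
  exact (hB hW e he heI).not_gt (hL i hi (e, B) hpos)

/-- A quantity that decreases with every step of the algorithm. -/
noncomputable def stateRank [Fintype E] (f : Finset E → ℝ) (L : ℕ) : State E → ℕ
  | .outer i _ => (L - i) * (Fintype.card (Finset E) + 2)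
  | .inner i B C => (L - i) * (Fintype.card (Finset E) + 2) + (valueRank f (B ∪ C) + 1)

theorem terminates [Fintype E] (hf : Submodular f) (hI : ∀ S T, S ⊆ T → I T → I S)
    (hε : 0 < ε) (hα : 0 < α) : Terminates f I ε α := by
  rintro ⟨s, hs0, hs⟩
  obtain ⟨L, hL⟩ := exists_not_canExtend (f := f) (I := I) (α := α)
  have hinv : ∀ n, StateInv f I α (Exhausted f I α) (s n) := by
    intro n
    refine StateInv.of_reachable (ε := ε) hf hI (exhausted_zero hα) ?_ ?_
    · intro j B C _ _ _ _ _ hno _ y hy hyI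
      exact marg_lt_of_no_improvement hno hy hyI
    · induction n with
      | zero => rw [hs0]
      | succ n ih => exact ih.tail (hs n)
  have hdec : ∀ n, stateRank f L (s (n + 1)) < stateRank f L (s n) := by
    intro n
    have hi := hinv n
    have hst := hs n
    generalize s n = a at hi hst
    generalize s (n + 1) = b at hst
    cases hst with
    | enter i B h =>
      have hiL : i < L := by
        by_contra! hle
        exact hL i B hle (h.maxMarg_pos hf) hi h
      obtain ⟨m, rfl⟩ := Nat.exists_eq_add_of_lt hiL
      -- Entering an iteration frees `card + 2` units, more than the `valueRank + 1` then taken up.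
      have hle : valueRank f (B ∪ ∅) ≤ Fintype.card (Finset E) := card_le_univ _
      have h1 : i + m + 1 - (i + 1) = m := by omega
      have h2 : i + m + 1 - i = m + 1 := by omega
      simp only [stateRank, h1, h2]
      linarith
    | improve i B C S N h hN =>
      obtain ⟨hW, j, rfl, hRB, hBC, hI', hg⟩ := hi
      have := valueRank_lt (h.lt hf hε (threshold_pos hW _) hBC (fun y hy => ?_) hN)
      · simpa [stateRank] using this
      -- 2θ is the previous threshold, and elements of `C` were feasible additions to the exhausted
      -- set `B`.
      · rw [two_mul_threshold_succ]
        refine hRB hW y (fun h => disjoint_left.1 hBC h hy) (hI _ _ ?_ hI')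
        exact insert_subset (mem_union_right _ hy) subset_union_left
    | leave i B C h => simp [stateRank]
  have : ∀ n, stateRank f L (s n) + n ≤ stateRank f L (s 0) := by
    intro n
    induction n with
    | zero => simp
    | succ n ih => have := hdec n; omega
  have := this (stateRank f L (s 0) + 1)
  omega

end Algorithm

/-! ### Distributing the value of the solution to the elements of `O`. -/

section Charging

variable {E V : Type*} [DecidableEq E] [DecidableEq V] {M : Matroid V} {v : E → Finset V} {k : ℕ}
  {f : Finset E → ℝ} {ε α θ : ℝ} {O : Finset E} {pre : E → Finset E}

omit [DecidableEq E] in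
lemma feasible_iff {S : Finset E} : Feasible M v S ↔ M.Indep ((S.biUnion v : Finset V) : Set V) := by
  simp [Feasible]

omit [DecidableEq E] [DecidableEq V] in
lemma Feasible.mono {S T : Finset E} (h : S ⊆ T) (hT : Feasible M v T) : Feasible M v S :=
  Matroid.Indep.subset hT (Set.biUnion_subset_biUnion_left h)

/-- The order on `O` supplies the labelling in type (3): the earlier element is added first, and it
already belongs to the set conditioned on for the later one. -/
lemma isImprovement_pair (hf : Submodular f) {A : Finset E} {x₁ x₂ y : E}
    {I : Finset E → Prop} (hx₁ : x₁ ∉ A ∪ pre x₁) (hx₂ : x₂ ∉ A ∪ pre x₂) (hpre : x₁ ∈ pre x₂)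
    (hy : y ∈ A) (hI : I ((A ∪ {x₁, x₂}) \ {y}))
    (h₁ : θ ≤ marg f x₁ (A ∪ pre x₁)) (h₂ : θ ≤ marg f x₂ (A ∪ pre x₂)) :
    IsImprovement f I θ ε A {x₁, x₂} {y} := by
  have hx₁A : x₁ ∉ A := fun h => hx₁ (mem_union_left _ h)
  have hx₂A : x₂ ∉ A := fun h => hx₂ (mem_union_left _ h)
  refine ⟨by simp [hx₁A, hx₂A], by simpa using hy, hI,
    .inr (.inr ⟨x₁, x₂, y, ?_, rfl, rfl, ?_, ?_⟩)⟩
  · rintro rfl; exact hx₁ (mem_union_right _ hpre)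
  · exact h₁.trans (hf.marg_le subset_union_left hx₁)
  · exact h₂.trans (hf.marg_le
      (insert_subset (mem_union_right _ hpre) subset_union_left) hx₂)

/-- If there is no improvement, then the number of elements of `O` of large marginal contribution
that conflict with the solution in a single vertex is at most the size of the current block. -/
lemma card_single_conflict_le (hv : IsParity M v k) (hf : Submodular f)
    (hpre : ∀ o ∈ O, pre o ⊆ O.erase o)
    (hpre' : ∀ x ∈ O, ∀ y ∈ O, x ≠ y → x ∈ pre y ∨ y ∈ pre x)
    {B C : Finset E} {X X' : Finset V}
    (hX : M.Indep ((B.biUnion v ∪ X : Finset V) : Set V)) (hX'X : X' ⊆ X)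
    (hX' : M.Indep (((B ∪ C).biUnion v ∪ X' : Finset V) : Set V))
    (hrank : finRank M ((B ∪ C).biUnion v ∪ X) = ((B ∪ C).biUnion v ∪ X').card)
    (hno : ¬ ∃ S N, IsImprovement f (Feasible M v) θ ε (B ∪ C) S N ∧ N ⊆ C)
    {Q : Finset E} (hQ : ∀ o ∈ Q, o ∈ O ∧ o ∉ B ∪ C ∧ θ ≤ marg f o (B ∪ C ∪ pre o) ∧
      v o ⊆ X ∧ (v o \ X').card = 1) : Q.card ≤ C.card := by
  by_contra! hlt
  set A := B ∪ C with hA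
  set J := A.biUnion v ∪ X' with hJ
  set D := Q.biUnion fun o => v o \ X' with hD
  have hvd : ∀ {e e' z}, z ∈ v e → z ∈ v e' → e = e' := by
    intro e e' z h1 h2
    by_contra hne
    exact disjoint_left.1 (hv.disjoint e e' hne) h1 h2
  have hDX : D ⊆ X := by
    refine biUnion_subset.2 fun o ho => sdiff_subset.trans (hQ o ho).2.2.2.1
  have hDcard : D.card = Q.card := by
    rw [hD, card_biUnion fun a _ b _ hab =>
      (hv.disjoint a b hab).mono sdiff_subset sdiff_subset,
      sum_congr rfl fun o ho => (hQ o ho).2.2.2.2]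
    simp
  have hDJ : Disjoint D J := by
    rw [disjoint_left]
    intro z hz hzJ
    obtain ⟨o, ho, hzo⟩ := mem_biUnion.1 hz
    rw [mem_sdiff] at hzo
    rcases mem_union.1 hzJ with h | h
    · obtain ⟨e, he, hze⟩ := mem_biUnion.1 h
      exact (hQ o ho).2.1 (hvd hze hzo.1 ▸ he)
    · exact hzo.2 h
  -- Without the vertices of `C`, everything lies in the old independent set.
  have hrest : D ∪ J \ C.biUnion v ⊆ B.biUnion v ∪ X := by
    refine union_subset (hDX.trans subset_union_right) fun z hz => ?_
    rw [hJ, hA, union_biUnion] at hz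
    simp only [mem_sdiff, mem_union] at hz ⊢
    have := @hX'X z
    tauto
  have hrankD : finRank M (D ∪ J) = J.card := by
    refine le_antisymm ((finRank_mono M ?_).trans hrank.le) ?_
    · exact union_subset (hDX.trans subset_union_right)
        (union_subset_union_right hX'X)
    · rw [← finRank_eq_card hX']
      exact finRank_mono M subset_union_right
  obtain ⟨y, hy, d₁, hd₁, d₂, hd₂, hne, hind⟩ := exists_exchange_two hv.disjoint hX'
    (fun y hy => (subset_biUnion_of_mem v (mem_union_right B hy)).trans subset_union_left)
    hDJ (hX.subset (coe_subset.2 hrest)) hrankD (hDcard ▸ hlt)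
  obtain ⟨o₁, ho₁, hd₁⟩ := mem_biUnion.1 hd₁
  obtain ⟨o₂, ho₂, hd₂⟩ := mem_biUnion.1 hd₂
  have hyA : y ∈ A := mem_union_right _ hy
  obtain ⟨ho₁O, ho₁A, hm₁, -, hc₁⟩ := hQ o₁ ho₁
  obtain ⟨ho₂O, ho₂A, hm₂, -, hc₂⟩ := hQ o₂ ho₂
  have honly : ∀ {o d z}, (v o \ X').card = 1 → d ∈ v o \ X' → z ∈ v o → z ∉ X' → z = d :=
    fun h hd hz hz' => card_le_one.1 h.le _ (mem_sdiff.2 ⟨hz, hz'⟩) _ hd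
  have hone : o₁ ≠ o₂ := by
    rintro rfl
    exact hne (honly hc₂ hd₂ (mem_sdiff.1 hd₁).1 (mem_sdiff.1 hd₁).2)
  have hfeas : Feasible M v ((A ∪ {o₁, o₂}) \ {y}) := by
    rw [feasible_iff]
    refine hind.subset (coe_subset.2 fun z hz => ?_)
    obtain ⟨e, he, hze⟩ := mem_biUnion.1 hz
    simp only [mem_sdiff, mem_union, mem_insert, mem_singleton] at he
    have hzy : z ∉ v y := fun h => he.2 (hvd hze h)
    simp only [mem_insert, mem_sdiff]
    by_cases hzJ : z ∈ J
    · exact .inr (.inr ⟨hzJ, hzy⟩)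
    have hzX' : z ∉ X' := fun h => hzJ (mem_union_right _ h)
    rcases he.1 with h | rfl | rfl
    · exact absurd (mem_union_left _ (mem_biUnion.2 ⟨e, h, hze⟩)) hzJ
    · exact .inl (honly hc₁ hd₁ hze hzX')
    · exact .inr (.inl (honly hc₂ hd₂ hze hzX'))
  have hnp : ∀ {o}, o ∈ O → o ∉ A → o ∉ A ∪ pre o := fun ho hoA h =>
    (mem_union.1 h).elim hoA fun h => notMem_erase _ O (hpre _ ho h)
  rcases hpre' o₁ ho₁O o₂ ho₂O hone with h | h
  · exact hno ⟨_, _, isImprovement_pair hf (hnp ho₁O ho₁A) (hnp ho₂O ho₂A) h hyA hfeas hm₁ hm₂,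
      singleton_subset_iff.2 hy⟩
  · rw [pair_comm] at hfeas
    exact hno ⟨_, _, isImprovement_pair hf (hnp ho₂O ho₂A) (hnp ho₁O ho₁A) h hyA hfeas hm₂ hm₁,
      singleton_subset_iff.2 hy⟩

/-- After `i` iterations, the value of the current solution `B` can be distributed to the elements
of `O` such that each of them that conflicts with `B` receives at least the current threshold, and
each one of large marginal contribution receives enough to pay for it. -/
def ChargeInv (M : Matroid V) (v : E → Finset V) (k : ℕ) (f : Finset E → ℝ) (α : ℝ)
    (O : Finset E) (pre : E → Finset E) (i : ℕ) (B : Finset E) : Prop :=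
  ∃ (X : Finset V) (p : E → ℝ), M.Indep ((B.biUnion v ∪ X : Finset V) : Set V) ∧
    (∀ o, 0 ≤ p o) ∧ ∑ o ∈ O, p o ≤ (k + 1) * (f B - f ∅) ∧
    ∀ o ∈ O, o ∉ B → (¬ v o ⊆ X → threshold f α i ≤ p o) ∧
      ∀ j, 1 ≤ j → j ≤ i → threshold f α j ≤ marg f o (B ∪ pre o) → 2 * threshold f α j ≤ p o

lemma chargeInv_zero (hO : Feasible M v O) : ChargeInv M v k f α O pre 0 ∅ := by
  refine ⟨O.biUnion v, 0, ?_, fun _ => le_rfl, by simp, fun o ho _ => ⟨fun h => ?_, ?_⟩⟩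
  · rw [biUnion_empty, empty_union]; exact feasible_iff.1 hO
  · exact absurd (subset_biUnion_of_mem v ho) h
  · intro j h1 h2; omega

/-- The new payments total at most θ(k|C| + |C|), covered by k+1 times the gain θ|C| that `Grown`
guarantees. An element that was already in conflict holds m_i = 2θ, so it needs nothing new. -/
lemma ChargeInv.succ (hv : IsParity M v k) (hf : Submodular f)
    (hpre : ∀ o ∈ O, pre o ⊆ O.erase o)
    (hpre' : ∀ x ∈ O, ∀ y ∈ O, x ≠ y → x ∈ pre y ∨ y ∈ pre x)
    (hW : 0 < maxMarg f) {i : ℕ} {B C : Finset E} (h : ChargeInv M v k f α O pre i B)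
    (hBC : Disjoint B C) (hI : Feasible M v (B ∪ C))
    (hg : Grown f (threshold f α (i + 1)) B (B ∪ C))
    (hno : ¬ ∃ S N, IsImprovement f (Feasible M v) (threshold f α (i + 1)) ε (B ∪ C) S N ∧ N ⊆ C) :
    ChargeInv M v k f α O pre (i + 1) (B ∪ C) := by
  obtain ⟨X, p, hX, hp0, hp, hpo⟩ := h
  obtain ⟨X', hX'X, hX', hrank, hcard⟩ := exists_subset_indep_union hX (feasible_iff.1 hI)
    (biUnion_subset_biUnion_of_subset_left v subset_union_left)
  set θ := threshold f α (i + 1) with hθ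
  have hθi : threshold f α i = 2 * θ := (two_mul_threshold_succ i).symm
  have hθ0 : 0 < θ := threshold_pos hW _
  set Q := O.filter fun o => o ∉ B ∪ C ∧ θ ≤ marg f o (B ∪ C ∪ pre o) ∧
    v o ⊆ X ∧ (v o \ X').card = 1 with hQ
  have hQC : Q.card ≤ C.card := card_single_conflict_le hv hf hpre hpre' hX hX'X hX' hrank hno
    fun o ho => mem_filter.1 ho
  have hXC : (X \ X').card ≤ k * C.card := by
    refine hcard.trans ((card_le_card ?_).trans
      ((card_biUnion_le_card_mul C v k fun e _ => hv.card_le e).trans (mul_comm _ _).le))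
    rw [union_biUnion]
    intro z
    simp only [mem_sdiff, mem_union]
    tauto
  have hXsum : ∑ o ∈ O, (v o ∩ (X \ X')).card ≤ (X \ X').card := by
    rw [← card_biUnion fun a _ b _ hab =>
      (hv.disjoint a b hab).mono inter_subset_left inter_subset_left]
    exact card_le_card (biUnion_subset.2 fun _ _ => inter_subset_right)
  have hgain : θ * C.card ≤ f (B ∪ C) - f B := by
    have := hg.mul_card_le
    rwa [union_sdiff_cancel_left hBC] at this
  -- θ for each vertex lost in this iteration, plus a further θ for the single-conflict elements
  -- `Q`.
  refine ⟨X', fun o => p o + (θ * (v o ∩ (X \ X')).card + if o ∈ Q then θ else 0), hX',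
    fun o => ?_, ?_, fun o ho hoA => ?_⟩
  · have := hp0 o
    positivity
  · rw [sum_add_distrib, sum_add_distrib, ← mul_sum, ← sum_filter,
      filter_mem_eq_inter, inter_eq_right.2 (filter_subset _ _), sum_const, nsmul_eq_mul]
    have h1 : ∑ o ∈ O, ((v o ∩ (X \ X')).card : ℝ) ≤ k * C.card := by
      exact_mod_cast hXsum.trans hXC
    have h2 : (Q.card : ℝ) ≤ C.card := by exact_mod_cast hQC
    have h3 := mul_le_mul_of_nonneg_left h1 hθ0.le
    have h4 := mul_le_mul_of_nonneg_right h2 hθ0.le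
    have h5 := mul_le_mul_of_nonneg_left hgain (by positivity : (0 : ℝ) ≤ k + 1)
    linarith
  · have hoB : o ∉ B := fun h => hoA (mem_union_left _ h)
    obtain ⟨h1, h2⟩ := hpo o ho hoB
    have hpo0 := hp0 o
    have hite : 0 ≤ if o ∈ Q then θ else 0 := by positivity
    have hterm : 0 ≤ θ * (v o ∩ (X \ X')).card := by positivity
    have hinter : v o ⊆ X → v o ∩ (X \ X') = v o \ X' := by
      intro h
      ext z
      have := @h z
      simp only [mem_inter, mem_sdiff]
      tauto
    refine ⟨fun hoX' => ?_, fun j hj1 hj hm => ?_⟩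
    · by_cases hoX : v o ⊆ X
      · have : 1 ≤ (v o ∩ (X \ X')).card := by
          rw [hinter hoX, Nat.one_le_iff_ne_zero, Ne, card_eq_zero, sdiff_eq_empty_iff_subset]
          exact hoX'
        have : (1 : ℝ) ≤ (v o ∩ (X \ X')).card := by exact_mod_cast this
        nlinarith
      · have := h1 hoX
        linarith
    · rcases Nat.lt_or_ge i j with hij | hij
      · obtain rfl : j = i + 1 := by omega
        by_cases hoX : v o ⊆ X
        -- An element that loses no vertex would be an improvement of type (1).
        · have hoX' : ¬ v o ⊆ X' := by
            intro h
            refine (marg_lt_of_no_improvement hno hoA ?_).not_ge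
              (hm.trans (hf.marg_le subset_union_left fun hmem => ?_))
            · rw [feasible_iff, biUnion_insert]
              refine hX'.subset (coe_subset.2 (union_subset (h.trans subset_union_right)
                subset_union_left))
            · exact (mem_union.1 hmem).elim hoA fun h => notMem_erase _ O (hpre _ ho h)
          have hne : (v o \ X').card ≠ 0 := by
            rwa [Ne, card_eq_zero, sdiff_eq_empty_iff_subset]
          beta_reduce
          rw [hinter hoX]
          by_cases hone : (v o \ X').card = 1
          · have hoQ : o ∈ Q := mem_filter.2 ⟨ho, hoA, hm, hoX, hone⟩
            rw [if_pos hoQ, hone]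
            push_cast
            linarith
          · have : 2 ≤ (v o \ X').card := by omega
            have : (2 : ℝ) ≤ (v o \ X').card := by exact_mod_cast this
            nlinarith
        · have := h1 hoX
          linarith
      · have hle : marg f o (B ∪ C ∪ pre o) ≤ marg f o (B ∪ pre o) := by
          refine hf.marg_le (union_subset_union_left subset_union_left) fun hmem => ?_
          exact (mem_union.1 hmem).elim hoA fun h => notMem_erase _ O (hpre _ ho h)
        have := h2 j hj1 hij (hm.trans hle)
        linarith

/-- For every output of the algorithm, the elements of a feasible set can be paid for. -/
theorem exists_charging [Finite E] (hv : IsParity M v k) (hf : Submodular f)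
    (hO : Feasible M v O) (hpre : ∀ o ∈ O, pre o ⊆ O.erase o)
    (hpre' : ∀ x ∈ O, ∀ y ∈ O, x ≠ y → x ∈ pre y ∨ y ∈ pre x) (hW : 0 < maxMarg f)
    {A : Finset E} (hA : IsOutput f (Feasible M v) ε α A) :
    ∃ p : E → ℝ, (∀ o, 0 ≤ p o) ∧ ∑ o ∈ O, p o ≤ (k + 1) * (f A - f ∅) ∧
      ∀ o ∈ O, o ∉ A → ∀ j, 1 ≤ j → threshold f α j ≤ marg f o (A ∪ pre o) →
        2 * threshold f α j ≤ p o := by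
  obtain ⟨i, hreach, hend⟩ := hA
  have hinv : ChargeInv M v k f α O pre i A :=
    StateInv.of_reachable (R := ChargeInv M v k f α O pre) hf (fun S T h => Feasible.mono h)
      (chargeInv_zero hO)
      (fun j B C hW h hBC hI hg hno => h.succ hv hf hpre hpre' hW hBC hI hg hno) hreach
  obtain ⟨X, p, hX, hp0, hp, hpo⟩ := hinv
  refine ⟨p, hp0, hp, fun o ho hoA j hj hm => ?_⟩
  obtain ⟨h1, h2⟩ := hpo o ho hoA
  rcases Nat.lt_or_ge i j with hij | hij
  -- For thresholds never reached: a conflict-free `o` would keep the outer loop going, so `o` has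
  -- conflicts and holds at least m_i ≥ 2m_j.
  · have hoX : ¬ v o ⊆ X := by
      intro h
      refine hend ⟨o, hoA, ?_, ?_⟩
      · refine (threshold_pos hW j).trans_le
          (hm.trans (hf.marg_le subset_union_left fun hmem => ?_))
        exact (mem_union.1 hmem).elim hoA fun h => notMem_erase _ O (hpre _ ho h)
      · rw [feasible_iff, biUnion_insert]
        exact hX.subset (coe_subset.2 (union_subset (h.trans subset_union_right)
          subset_union_left))
    obtain ⟨m, rfl⟩ := Nat.exists_eq_add_of_le' hj
    rw [two_mul_threshold_succ]
    exact (threshold_antitone hW (by omega)).trans (h1 hoX)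
  · exact h2 j hj hij hm

end Charging

/-! ### Loss of an element as a function of its position between thresholds. -/

section Levels

/-- The loss of an element of weight `1`, as a function of its position between the
thresholds. -/
noncomputable def lossFun (d s : ℝ) : ℝ :=
  max (d - 2 * (2 : ℝ) ^ (-s)) ((d - 1) * (2 : ℝ) ^ (-s))

lemma continuous_lossFun (d : ℝ) : Continuous (lossFun d) := by
  have : Continuous fun s : ℝ => (2 : ℝ) ^ (-s) :=
    Real.continuous_const_rpow (by norm_num) |>.comp continuous_neg
  unfold lossFun
  fun_prop

lemma lossFun_nonneg {d : ℝ} (hd : 1 ≤ d) (s : ℝ) : 0 ≤ lossFun d s :=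
  le_max_of_le_right (mul_nonneg (by linarith) (by positivity))

lemma lossFun_le {d s : ℝ} (hd : 1 ≤ d) (hs : 0 ≤ s) : lossFun d s ≤ d := by
  have h1 : (2 : ℝ) ^ (-s) ≤ 1 := Real.rpow_le_one_of_one_le_of_nonpos (by norm_num) (by linarith)
  have h2 : (0 : ℝ) < (2 : ℝ) ^ (-s) := by positivity
  refine max_le (by linarith) ?_
  nlinarith

variable {E : Type*} [DecidableEq E] {f : Finset E → ℝ} {α : ℝ}

/-- The largest threshold not above x has index j = -⌊log₂(x/W) - α⌋; x ≤ W and α > 0 force j ≥ 1.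
-/
lemma exists_threshold_eq {x : ℝ} (hx : 0 < x) (hxW : x ≤ maxMarg f) (hα : 0 < α) :
    ∃ j, 1 ≤ j ∧ threshold f α j =
      x * (2 : ℝ) ^ (-Int.fract (Real.logb 2 (x / maxMarg f) - α)) := by
  have hW : 0 < maxMarg f := hx.trans_le hxW
  set c := Real.logb 2 (x / maxMarg f) - α with hc
  have hlog : Real.logb 2 (x / maxMarg f) ≤ 0 :=
    Real.logb_nonpos (by norm_num) (by positivity) ((div_le_one hW).2 hxW)
  have hfl : ⌊c⌋ < 0 := Int.floor_lt.2 (by push_cast; linarith)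
  refine ⟨(-⌊c⌋).toNat, by omega, ?_⟩
  have hj : (((-⌊c⌋).toNat : ℕ) : ℝ) = -(⌊c⌋ : ℝ) := by
    have : (((-⌊c⌋).toNat : ℕ) : ℤ) = -⌊c⌋ := Int.toNat_of_nonneg (by omega)
    exact_mod_cast this
  have h2 : (0 : ℝ) < 2 := by norm_num
  have hexp : (2 : ℝ) ^ (-Int.fract c)
      = 2 ^ α * 2 ^ (⌊c⌋ : ℝ) / (2 : ℝ) ^ Real.logb 2 (x / maxMarg f) := by
    rw [← Real.rpow_add h2, ← Real.rpow_sub h2, Int.fract]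
    congr 1
    rw [hc]
    ring
  rw [hexp, Real.rpow_logb h2 (by norm_num) (by positivity), threshold, ← Real.rpow_natCast, hj,
    Real.rpow_neg h2.le]
  field_simp

/-- The loss of an element of weight `w` and marginal contribution `u ≤ w` whose payment `p` is
determined by the largest threshold below `u`. -/
lemma mul_sub_le_lossFun {d u w p : ℝ} (hd : 1 ≤ d) (huw : u ≤ w) (hw : 0 < w)
    (hwW : w ≤ maxMarg f) (hα : 0 < α) (hp : 0 ≤ p)
    (h : ∀ j, 1 ≤ j → threshold f α j ≤ u → 2 * threshold f α j ≤ p) :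
    d * u - p ≤ w * lossFun d (Int.fract (Real.logb 2 (w / maxMarg f) - α)) := by
  obtain ⟨j, hj, hjw⟩ := exists_threshold_eq hw hwW hα
  set s := Int.fract (Real.logb 2 (w / maxMarg f) - α)
  by_cases hu : threshold f α j ≤ u
  · have h1 := h j hj hu
    have h2 : w * (d - 2 * (2 : ℝ) ^ (-s)) ≤ w * lossFun d s :=
      mul_le_mul_of_nonneg_left (le_max_left _ _) hw.le
    rw [hjw] at h1
    nlinarith
  · push Not at hu
    have h2 : w * ((d - 1) * (2 : ℝ) ^ (-s)) ≤ w * lossFun d s :=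
      mul_le_mul_of_nonneg_left (le_max_right _ _) hw.le
    rw [hjw] at hu
    have h3 : (d - 1) * u ≤ (d - 1) * (w * (2 : ℝ) ^ (-s)) :=
      mul_le_mul_of_nonneg_left hu.le (by linarith)
    suffices u ≤ p ∨ d * u - p ≤ 0 by
      rcases this with h4 | h4
      · linarith
      · exact h4.trans (mul_nonneg hw.le (lossFun_nonneg hd s))
    rcases le_or_gt u 0 with hu0 | hu0
    · right; nlinarith
    · left
      -- The largest threshold not above `u` is at least u/2, so the payment covers `u` itself.
      obtain ⟨i, hi, hiu⟩ := exists_threshold_eq hu0 (huw.trans hwW) hα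
      set t := Int.fract (Real.logb 2 (u / maxMarg f) - α)
      have ht0 : 0 ≤ t := Int.fract_nonneg _
      have ht1 : t < 1 := Int.fract_lt_one _
      have h5 : (2 : ℝ) ^ (-t) ≤ 1 :=
        Real.rpow_le_one_of_one_le_of_nonpos (by norm_num) (by linarith)
      have h6 : (1 / 2 : ℝ) ≤ (2 : ℝ) ^ (-t) := by
        have : (2 : ℝ) ^ (-1 : ℝ) ≤ (2 : ℝ) ^ (-t) :=
          Real.rpow_le_rpow_of_exponent_le (by norm_num) (by linarith)
        rwa [Real.rpow_neg_one, ← one_div] at this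
      have h7 := h i hi (by rw [hiu]; nlinarith)
      rw [hiu] at h7
      nlinarith

end Levels

/-! ### Averaging over the random shift α. -/

section Integrals

open MeasureTheory

lemma integral_two_rpow_neg (a b : ℝ) :
    ∫ s in a..b, (2 : ℝ) ^ (-s) = ((2 : ℝ) ^ (-a) - (2 : ℝ) ^ (-b)) / Real.log 2 := by
  have hlog : Real.log 2 ≠ 0 := (Real.log_pos (by norm_num)).ne'
  have hder : ∀ x ∈ Set.uIcc a b,
      HasDerivAt (fun s : ℝ => -((2 : ℝ) ^ (-s)) / Real.log 2) ((2 : ℝ) ^ (-x)) x := by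
    intro x _
    have := (((hasDerivAt_id x).neg.const_rpow (a := 2) (by norm_num)).neg.div_const (Real.log 2))
    refine this.congr_deriv ?_
    field_simp
    rfl
  rw [intervalIntegral.integral_eq_sub_of_hasDerivAt hder]
  · ring
  · exact (Real.continuous_const_rpow (by norm_num) |>.comp continuous_neg).intervalIntegrable _ _

/-- The two branches of the maximum cross where 2^{-s} = d/(d+1), that is at s₀ = log₂(1+1/d). The
exponential parts of the two integrals cancel. -/
lemma integral_lossFun {d : ℝ} (hd : 1 ≤ d) :
    ∫ s in (0 : ℝ)..1, lossFun d s = d - d * Real.logb 2 (1 + 1 / d) := by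
  have hd0 : 0 < d := by linarith
  have h2 : (0 : ℝ) < 2 := by norm_num
  set s₀ := Real.logb 2 (1 + 1 / d) with hs₀
  have hpow : (2 : ℝ) ^ (-s₀) = d / (d + 1) := by
    rw [Real.rpow_neg h2.le, Real.rpow_logb h2 (by norm_num) (by positivity)]
    field_simp
  have hs0 : 0 ≤ s₀ := Real.logb_nonneg (by norm_num) (by simp [hd0.le])
  have hs1 : s₀ ≤ 1 := by
    rw [hs₀, Real.logb_le_iff_le_rpow (by norm_num) (by positivity), Real.rpow_one]
    have := (div_le_one hd0).2 hd
    linarith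
  have hint : ∀ a b, IntervalIntegrable (lossFun d) volume a b :=
    fun a b => (continuous_lossFun d).intervalIntegrable a b
  have hint2 : ∀ a b, IntervalIntegrable (fun s : ℝ => (2 : ℝ) ^ (-s)) volume a b := fun a b =>
    (Real.continuous_const_rpow (by norm_num) |>.comp continuous_neg).intervalIntegrable a b
  have hlog : Real.log 2 ≠ 0 := (Real.log_pos (by norm_num)).ne'
  rw [← intervalIntegral.integral_add_adjacent_intervals (hint 0 s₀) (hint s₀ 1)]
  have e1 : ∫ s in (0 : ℝ)..s₀, lossFun d s = ∫ s in (0 : ℝ)..s₀, (d - 1) * (2 : ℝ) ^ (-s) := by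
    refine intervalIntegral.integral_congr fun s hs => ?_
    rw [Set.uIcc_of_le hs0] at hs
    have : d / (d + 1) ≤ (2 : ℝ) ^ (-s) := by
      rw [← hpow]; exact Real.rpow_le_rpow_of_exponent_le (by norm_num) (by linarith [hs.2])
    rw [div_le_iff₀ (by linarith)] at this
    exact max_eq_right (by linarith)
  have e2 : ∫ s in s₀..1, lossFun d s = ∫ s in s₀..1, (d - 2 * (2 : ℝ) ^ (-s)) := by
    refine intervalIntegral.integral_congr fun s hs => ?_
    rw [Set.uIcc_of_le hs1] at hs
    have : (2 : ℝ) ^ (-s) ≤ d / (d + 1) := by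
      rw [← hpow]; exact Real.rpow_le_rpow_of_exponent_le (by norm_num) (by linarith [hs.1])
    rw [le_div_iff₀ (by linarith)] at this
    exact max_eq_left (by linarith)
  rw [e1, e2, intervalIntegral.integral_const_mul, intervalIntegral.integral_sub
    intervalIntegrable_const ((hint2 _ _).const_mul 2), intervalIntegral.integral_const_mul,
    integral_two_rpow_neg, integral_two_rpow_neg, intervalIntegral.integral_const, hpow,
    neg_zero, Real.rpow_zero, Real.rpow_neg_one, smul_eq_mul]
  field_simp
  ring

/-- Follows from log(1+x) ≥ 2x/(x+2) at x = 1/d and a numerical bound on log 2. Only this estimate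
uses 2 ≤ d; elsewhere 1 ≤ d suffices. -/
lemma approximation_factor_le {d : ℝ} (hd : 2 ≤ d) :
    (1 - 1 / d) / (2 * Real.log 2) + (d + 1) / (2 * d) ≤ d * Real.logb 2 (1 + 1 / d) := by
  have hd0 : 0 < d := by linarith
  have hlog : 0 < Real.log 2 := Real.log_pos (by norm_num)
  have hl2 : Real.log 2 < 0.6932 := Real.log_two_lt_d9.trans (by norm_num)
  have h1 : 2 / (2 * d + 1) ≤ Real.log (1 + 1 / d) := by
    refine le_trans (le_of_eq ?_) (Real.le_log_one_add_of_nonneg (by positivity))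
    field_simp
    ring
  have h2 : (d - 1) + (d + 1) * Real.log 2 ≤ 2 * d ^ 2 * (2 / (2 * d + 1)) := by
    rw [mul_div_assoc', le_div_iff₀ (by linarith)]
    nlinarith
  have h3 : (d - 1) + (d + 1) * Real.log 2 ≤ 2 * d ^ 2 * Real.log (1 + 1 / d) :=
    h2.trans (mul_le_mul_of_nonneg_left h1 (by positivity))
  have e1 : (1 - 1 / d) / (2 * Real.log 2) + (d + 1) / (2 * d)
      = ((d - 1) + (d + 1) * Real.log 2) / (2 * d * Real.log 2) := by
    field_simp
  have e2 : d * Real.logb 2 (1 + 1 / d)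
      = (2 * d ^ 2 * Real.log (1 + 1 / d)) / (2 * d * Real.log 2) := by
    rw [Real.logb]
    field_simp
  rw [e1, e2]
  exact div_le_div_of_nonneg_right h3 (by positivity)

/-- Translation and reflection preserve the uniform distribution modulo 1, so the position of a
weight between thresholds is uniform. -/
lemma integral_fract_sub (g : ℝ → ℝ) (c : ℝ) :
    ∫ x in (0 : ℝ)..1, g (Int.fract (c - x)) = ∫ x in (0 : ℝ)..1, g x := by
  have hper : Function.Periodic (fun x : ℝ => g (Int.fract x)) 1 := fun x => by
    simp
  rw [intervalIntegral.integral_comp_sub_left (fun x => g (Int.fract x)) c, sub_zero]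
  have := hper.intervalIntegral_add_eq (c - 1) 0
  rw [sub_add_cancel, zero_add] at this
  rw [this, intervalIntegral.integral_of_le zero_le_one, intervalIntegral.integral_of_le zero_le_one,
    ← integral_Ico_eq_integral_Ioc, ← integral_Ico_eq_integral_Ioc]
  refine setIntegral_congr_fun measurableSet_Ico fun x hx => ?_
  rw [Int.fract_eq_self.2 hx]

variable {Ω : Type*} [MeasurableSpace Ω] {P : Measure Ω} {α : Ω → ℝ}

lemma map_eq_restrict_of_isUniform (hα : pdf.IsUniform α (Set.Ioc 0 1) P volume) :
    P.map α = (volume : Measure ℝ).restrict (Set.Ioc 0 1) := by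
  rw [pdf.IsUniform] at hα
  rw [hα, ProbabilityTheory.cond]
  simp

lemma aemeasurable_of_isUniform (hα : pdf.IsUniform α (Set.Ioc 0 1) P volume) :
    AEMeasurable α P := pdf.IsUniform.aemeasurable (μ := volume) (by simp) (by simp) hα

lemma ae_pos_of_isUniform (hα : pdf.IsUniform α (Set.Ioc 0 1) P volume) : ∀ᵐ ω ∂P, 0 < α ω := by
  refine ae_of_ae_map (p := fun x => 0 < x) (aemeasurable_of_isUniform hα) ?_
  rw [map_eq_restrict_of_isUniform hα]
  filter_upwards [ae_restrict_mem measurableSet_Ioc] with x hx using hx.1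

lemma measurable_lossFun_fract (d c : ℝ) :
    Measurable fun x : ℝ => lossFun d (Int.fract (c - x)) :=
  (continuous_lossFun d).measurable.comp (measurable_fract.comp (measurable_const.sub measurable_id))

lemma integral_lossFun_isUniform (hα : pdf.IsUniform α (Set.Ioc 0 1) P volume) {d : ℝ}
    (hd : 1 ≤ d) (c : ℝ) :
    ∫ ω, lossFun d (Int.fract (c - α ω)) ∂P = d - d * Real.logb 2 (1 + 1 / d) := by
  have hm := measurable_lossFun_fract d c
  rw [← integral_map (f := fun x => lossFun d (Int.fract (c - x)))
    (aemeasurable_of_isUniform hα) hm.aestronglyMeasurable, map_eq_restrict_of_isUniform hα,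
    ← intervalIntegral.integral_of_le zero_le_one, integral_fract_sub, integral_lossFun hd]

lemma integrable_lossFun [IsProbabilityMeasure P]
    (hα : pdf.IsUniform α (Set.Ioc 0 1) P volume) {d : ℝ} (hd : 1 ≤ d) (c : ℝ) :
    Integrable (fun ω => lossFun d (Int.fract (c - α ω))) P := by
  refine Integrable.of_bound (C := d) ((measurable_lossFun_fract d c).comp_aemeasurable
    (aemeasurable_of_isUniform hα)).aestronglyMeasurable (.of_forall fun ω => ?_)
  rw [Real.norm_of_nonneg (lossFun_nonneg hd _)]
  exact lossFun_le hd (Int.fract_nonneg _)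

lemma integrable_comp_of_finite {X : Type*} [Finite X] [IsProbabilityMeasure P] {A : Ω → X}
    (hA : ∀ S, MeasurableSet (A ⁻¹' {S})) (h : X → ℝ) : Integrable (fun ω => h (A ω)) P := by
  let _ : MeasurableSpace X := ⊤
  have hAm : Measurable A := measurable_to_countable' hA
  obtain ⟨C, hC⟩ := (Set.finite_range fun S => ‖h S‖).bddAbove
  exact Integrable.of_bound (C := C) (measurable_from_top.comp hAm).aestronglyMeasurable
    (.of_forall fun ω => hC ⟨A ω, rfl⟩)

end Integrals

/-! ### Guarantee for fixed α, and the expectation bound. -/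

section Guarantee

open MeasureTheory

variable {E V : Type*} [Fintype E] [DecidableEq E] {M : Matroid V} {v : E → Finset V} {k : ℕ}
  {f : Finset E → ℝ} {ε : ℝ} {O : Finset E}

/-- The guarantee for a fixed value of `α`. -/
theorem exists_weights (hv : IsParity M v k) (hf : Submodular f) (hf0 : ∀ S, 0 ≤ f S)
    (hO : Feasible M v O) (hOf : StrictlyDownMonotone f O) {d : ℝ} (hd : 1 ≤ d) :
    ∃ w : E → ℝ, ∑ o ∈ O, w o = f O - f ∅ ∧ ∀ (α : ℝ) (A : Finset E), 0 < α →
      IsOutput f (Feasible M v) ε α A →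
      d * (f (O ∪ A) - f A) ≤ (k + 1) * f A +
        ∑ o ∈ O, w o * lossFun d (Int.fract (Real.logb 2 (w o / maxMarg f) - α)) := by
  classical
  obtain ⟨pre, hpre, hpre', hsum⟩ := exists_predecessors O
  have hnot : ∀ o ∈ O, o ∉ pre o := fun o ho h => notMem_erase o O (hpre o ho h)
  refine ⟨fun o => marg f o (pre o), by simpa using hsum f ∅, fun α A hα hA => ?_⟩
  have hfA := hf0 A
  -- Positivity of W, needed for the charging, comes from an element of `O`.
  rcases O.eq_empty_or_nonempty with rfl | ⟨x, hx⟩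
  · simp only [empty_union, sub_self, mul_zero, sum_empty, add_zero]
    positivity
  have hwpos : ∀ o ∈ O, 0 < marg f o (pre o) := fun o ho =>
    (hOf o ho).trans_le (hf.marg_le (hpre o ho) (notMem_erase o O))
  have hwW : ∀ o ∈ O, marg f o (pre o) ≤ maxMarg f := fun o ho =>
    (hf.marg_le (empty_subset _) (hnot o ho)).trans (marg_le_maxMarg f o)
  obtain ⟨p, hp0, hp, hpo⟩ := exists_charging hv hf hO hpre hpre'
    ((hwpos x hx).trans_le (hwW x hx)) hA
  have hterm : ∀ o ∈ O, d * marg f o (A ∪ pre o) - p o ≤ marg f o (pre o) *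
      lossFun d (Int.fract (Real.logb 2 (marg f o (pre o) / maxMarg f) - α)) := by
    intro o ho
    by_cases hoA : o ∈ A
    · rw [marg_of_mem (mem_union_left _ hoA)]
      have := mul_nonneg (hwpos o ho).le (lossFun_nonneg hd
        (Int.fract (Real.logb 2 (marg f o (pre o) / maxMarg f) - α)))
      have := hp0 o
      linarith
    · exact mul_sub_le_lossFun hd
        (hf.marg_le subset_union_right fun h => (mem_union.1 h).elim hoA (hnot o ho))
        (hwpos o ho) (hwW o ho) hα (hp0 o) (hpo o ho hoA)
  have h1 := sum_le_sum hterm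
  rw [sum_sub_distrib, ← mul_sum, hsum, union_comm] at h1
  have h2 := mul_nonneg (by positivity : (0 : ℝ) ≤ k + 1) (hf0 ∅)
  linarith

end Guarantee

end MatroidParity

open MatroidParity in
theorem mainTheorem3 {E V Ω : Type*} [Fintype E] [DecidableEq E]
    (k : ℕ) (M : Matroid V) (v : E → Finset V) (hv : MatroidParity.IsParity M v k)
    (f : Finset E → ℝ) (hf : MatroidParity.Submodular f) (hf0 : ∀ S, 0 ≤ f S)
    (ε : ℝ) (hε0 : 0 < ε) (hε1 : ε < 1) :
    (∀ a ∈ Set.Ioc (0 : ℝ) 1,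
      MatroidParity.Terminates f (MatroidParity.Feasible M v) ε a) ∧
    ∀ [MeasurableSpace Ω] (P : MeasureTheory.Measure Ω) [MeasureTheory.IsProbabilityMeasure P]
      (α : Ω → ℝ) (_ : MeasureTheory.pdf.IsUniform α (Set.Ioc 0 1) P MeasureTheory.volume)
      (A : Ω → Finset E) (_ : ∀ S, MeasurableSet (A ⁻¹' {S}))
      (_ : ∀ᵐ ω ∂P, MatroidParity.IsOutput f (MatroidParity.Feasible M v) ε (α ω) (A ω))
      (d : ℝ) (_ : 2 ≤ d)
      (O : Finset E) (_ : MatroidParity.Feasible M v O)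
      (_ : MatroidParity.StrictlyDownMonotone f O),
      ((1 - 1 / d) / (2 * Real.log 2) + (d + 1) / (2 * d)) * f O
          + d * ∫ ω, MatroidParity.margSet f (A ω) O ∂P
        ≤ (k + d + 1 + 2 * ε) * ∫ ω, f (A ω) ∂P := by
  refine ⟨fun a ha => terminates hf (fun S T h => Feasible.mono h) hε0 ha.1, ?_⟩
  intro _ P _ α hα A hA hout d hd O hO hOf
  have hd1 : 1 ≤ d := by linarith
  obtain ⟨w, hw, hmain⟩ := exists_weights (ε := ε) hv hf hf0 hO hOf hd1
  have hint := fun h : Finset E → ℝ => integrable_comp_of_finite (P := P) hA h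
  have hloss := fun o : E => (integrable_lossFun hα hd1
    (Real.logb 2 (w o / maxMarg f))).const_mul (w o)
  have hmono := MeasureTheory.integral_mono_ae
    (((hint fun S => f (O ∪ S)).sub (hint f)).const_mul d)
    (((hint f).const_mul ((k : ℝ) + 1)).add
      (MeasureTheory.integrable_finsetSum O fun o _ => hloss o))
    (by filter_upwards [hout, ae_pos_of_isUniform hα] with ω h1 h2 using hmain _ _ h2 h1)
  simp only [Pi.add_apply, Pi.sub_apply] at hmono
  rw [MeasureTheory.integral_const_mul, MeasureTheory.integral_sub (hint fun S => f (O ∪ S)) (hint f),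
    MeasureTheory.integral_add ((hint f).const_mul _)
      (MeasureTheory.integrable_finsetSum O fun o _ => hloss o),
    MeasureTheory.integral_const_mul,
    MeasureTheory.integral_finsetSum O fun o _ => hloss o] at hmono
  simp only [MeasureTheory.integral_const_mul, integral_lossFun_isUniform hα hd1] at hmono
  rw [← Finset.sum_mul, hw] at hmono
  have hmarg : ∫ ω, margSet f (A ω) O ∂P = ∫ ω, f (O ∪ A ω) ∂P - f O := by
    simp only [margSet]
    rw [MeasureTheory.integral_sub (hint fun S => f (O ∪ S)) (MeasureTheory.integrable_const _)]
    simp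
  have hnonneg : 0 ≤ ∫ ω, f (A ω) ∂P := MeasureTheory.integral_nonneg fun ω => hf0 _
  have hfac := mul_le_mul_of_nonneg_right (approximation_factor_le hd) (hf0 O)
  have hloss0 : 0 ≤ d - d * Real.logb 2 (1 + 1 / d) := by
    rw [← integral_lossFun hd1]
    exact intervalIntegral.integral_nonneg zero_le_one fun s _ => lossFun_nonneg hd1 s
  -- The terms in f(∅) and 2ε have the favourable sign and are dropped.
  have h1 := mul_nonneg hloss0 (hf0 ∅)
  have h2 := mul_nonneg hε0.le hnonneg
  rw [hmarg]
  linarith
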